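/- Let $r\ge 2$ be an integer and let $\mathbf a,\mathbf b,\mathbf c\in\mathbb Z^{r-2}$. Let $\mathbf D_{r+1}$ be the matrix with $r+1$ rows whose columns are $\mathbf e_i-\mathbf e_j$ for all $1\le i<j\le r+1$, where $\mathbf e_1,\dots,\mathbf e_{r+1}$ are the standard unit vectors, and let $$\mathbf A=\left[\begin{array}{c|ccc} & \mathbf a&\mathbf b&\mathbf c\\ \mathbf D_{r+1} & 1&0&0\\ &0&1&0\\ &0&0&1\end{array}\right],$$ an integer matrix with $r+1$ rows and $\binom{r+1}{2}+3$ columns. Suppose that the rows of $\mathbf A$ sum to the zero vector and that no two columns of $\mathbf A$ are parallel (that is, no column is a nonzero scalar multiple of another column). If $\mathbf a,\mathbf b,\mathbf c$ are pairwise distinct, then $\mathbf A$ is not $3$-modular; that is, some $\operatorname{rank}(\mathbf A)\times\operatorname{rank}(\mathbf A)$ submatrix of $\mathbf A$ has determinant greater than $3$ in absolute value. -/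

import Mathlib

/-- An integer matrix is `Δ`-modular if every `rank A × rank A` submatrix of `A` has determinant
at most `Δ` in absolute value. A submatrix is given by injective choices of rows and columns; the
order in which they are chosen does not affect the absolute value of the determinant. -/
def IsDeltaModular {ι κ : Type*} [Fintype ι] [Fintype κ] (Δ : ℕ) (A : Matrix ι κ ℤ) : Prop :=
  ∀ (f : Fin (A.map (Int.cast : ℤ → ℚ)).rank ↪ ι) (g : Fin (A.map (Int.cast : ℤ → ℚ)).rank ↪ κ),
    |(A.submatrix f g).det| ≤ (Δ : ℤ)

/-- Two integer vectors are parallel if one is a nonzero (rational) scalar multiple of the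
other. -/
def IsParallel {ι : Type*} (u v : ι → ℤ) : Prop :=
  ∃ t : ℚ, t ≠ 0 ∧ ∀ i, (v i : ℚ) = t * (u i : ℚ)

/-- No two columns of `A` (at different positions) are parallel. -/
def NoParallelColumns {ι κ : Type*} (A : Matrix ι κ ℤ) : Prop :=
  ∀ j k : κ, j ≠ k → ¬ IsParallel (fun i => A i j) (fun i => A i k)

/-- The matrix `D_k` with `k` rows, whose columns are `e_i - e_j` for all `i < j`. -/
def cliqueMatrix (k : ℕ) : Matrix (Fin k) {p : Fin k × Fin k // p.1 < p.2} ℤ :=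
  Matrix.of fun i p => (Pi.single p.1.1 1 - Pi.single p.1.2 1 : Fin k → ℤ) i

/-- The `(m + 3) × 3` matrix whose first `m` rows form `[a b c]` and whose last three rows form
the identity matrix. -/
def extensionColumns {m : ℕ} (a b c : Fin m → ℤ) : Matrix (Fin (m + 3)) (Fin 3) ℤ :=
  Matrix.of fun i j =>
    (Fin.append (![a, b, c] j) (Pi.single j 1 : Fin 3 → ℤ) : Fin (m + 3) → ℤ) i

/-- The matrix `[D_{m+3} | Y]`, where `Y` has the rows of `[a b c]` on top of a `3 × 3` identity
matrix. -/
def cliqueExtension {m : ℕ} (a b c : Fin m → ℤ) :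
    Matrix (Fin (m + 3)) ({p : Fin (m + 3) × Fin (m + 3) // p.1 < p.2} ⊕ Fin 3) ℤ :=
  Matrix.fromCols (cliqueMatrix (m + 3)) (extensionColumns a b c)

/-! Colour the rows with four colours and span each colour class by a tree of columns of `D`. These
columns together with the last three form a rank-sized minor; contracting the trees shows it equals,
up to sign, the `3 × 3` determinant of the colour-class sums with one class dropped
(`abs_det_forest`). So `3`-modularity bounds all these small determinants
(`boundedMinors_of_isDeltaModular`).

The zero row sum gives `a`, `b`, `c` equal entry sums, and non-parallelism gives each a positive
entry (`exists_pos_of_not_isParallel`). If the positive supports are disjoint, one determinant is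
too large. Otherwise shared positive entries are all `1` (`BoundedMinors.ne_two`). Distinct columns
with equal sums differ in both directions, and the rows witnessing this, with the shared row, yield
a determinant above `3`, whether the third column is positive in that row
(`BoundedMinors.false_of_common`) or not (`BoundedMinors.false_of_pair`). -/

/-- Colour the rows of the three columns `(y j, e_j)` with four colours, the last of which is
ignored: the `3 × 3` matrix of the sums over the colour classes has determinant at most `3`. -/
def BoundedMinors {m : ℕ} (y : Fin 3 → Fin m → ℤ) : Prop :=
  ∀ (ε : Fin 3 → Fin 4) (χ : Fin m → Fin 4),
    |(Matrix.of fun k j : Fin 3 => (if ε j = k.castSucc then (1 : ℤ) else 0) +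
      ∑ i with χ i = k.castSucc, y j i).det| ≤ 3

/-! ### Column symmetry and explicit row sets -/

theorem BoundedMinors.perm {m : ℕ} {y : Fin 3 → Fin m → ℤ} (h : BoundedMinors y)
    (σ : Equiv.Perm (Fin 3)) : BoundedMinors (y ∘ σ) := by
  intro ε χ
  have key := Matrix.det_permute' σ (Matrix.of fun k j : Fin 3 =>
    (if (ε ∘ σ.symm) j = k.castSucc then (1 : ℤ) else 0) + ∑ i with χ i = k.castSucc, y j i)
  have h1 : |((Equiv.Perm.sign σ : ℤˣ) : ℤ)| = 1 := Int.isUnit_iff_abs_eq.1 (Units.isUnit _)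
  have h2 := congrArg abs key
  rw [abs_mul, Int.cast_id, h1, one_mul] at h2
  have h3 := h (ε ∘ σ.symm) χ
  rw [← h2] at h3
  convert h3 using 3
  ext k j
  simp

theorem BoundedMinors.swap01 {m : ℕ} {a b c : Fin m → ℤ} (h : BoundedMinors ![a, b, c]) :
    BoundedMinors ![b, a, c] := by
  convert h.perm (Equiv.swap 0 1) using 1
  ext j
  fin_cases j <;> rfl

theorem BoundedMinors.swap12 {m : ℕ} {a b c : Fin m → ℤ} (h : BoundedMinors ![a, b, c]) :
    BoundedMinors ![a, c, b] := by
  convert h.perm (Equiv.swap 1 2) using 1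
  ext j
  fin_cases j <;> rfl

theorem BoundedMinors.det_le {m : ℕ} {a b c : Fin m → ℤ} (h : BoundedMinors ![a, b, c])
    (ε : Fin 3 → Fin 4) {S T U : Finset (Fin m)}
    (hST : Disjoint S T) (hSU : Disjoint S U) (hTU : Disjoint T U) :
    |(!![(if ε 0 = 0 then 1 else 0) + ∑ i ∈ S, a i, (if ε 1 = 0 then 1 else 0) + ∑ i ∈ S, b i,
          (if ε 2 = 0 then 1 else 0) + ∑ i ∈ S, c i;
        (if ε 0 = 1 then 1 else 0) + ∑ i ∈ T, a i, (if ε 1 = 1 then 1 else 0) + ∑ i ∈ T, b i,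
          (if ε 2 = 1 then 1 else 0) + ∑ i ∈ T, c i;
        (if ε 0 = 2 then 1 else 0) + ∑ i ∈ U, a i, (if ε 1 = 2 then 1 else 0) + ∑ i ∈ U, b i,
          (if ε 2 = 2 then 1 else 0) + ∑ i ∈ U, c i] : Matrix (Fin 3) (Fin 3) ℤ).det| ≤ 3 := by
  classical
  rw [Finset.disjoint_left] at hST hSU hTU
  -- Rows outside the three sets get the ignored colour `3`.
  have := h ε fun i => if i ∈ S then 0 else if i ∈ T then 1 else if i ∈ U then 2 else 3
  have hS : (Finset.univ.filter fun i =>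
      (if i ∈ S then (0 : Fin 4) else if i ∈ T then 1 else if i ∈ U then 2 else 3) = 0) = S := by
    ext i
    simp only [Finset.mem_filter, Finset.mem_univ, true_and]
    split_ifs <;> simp_all
  have hT : (Finset.univ.filter fun i =>
      (if i ∈ S then (0 : Fin 4) else if i ∈ T then 1 else if i ∈ U then 2 else 3) = 1) = T := by
    ext i
    have := @hST i
    simp only [Finset.mem_filter, Finset.mem_univ, true_and]
    split_ifs <;> simp_all
  have hU : (Finset.univ.filter fun i =>
      (if i ∈ S then (0 : Fin 4) else if i ∈ T then 1 else if i ∈ U then 2 else 3) = 2) = U := by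
    ext i
    have := @hSU i
    have := @hTU i
    simp only [Finset.mem_filter, Finset.mem_univ, true_and]
    split_ifs <;> simp_all
  convert this using 3
  ext k j
  have c0 : (0 : Fin 3).castSucc = 0 := rfl
  have c1 : (1 : Fin 3).castSucc = 1 := rfl
  have c2 : (2 : Fin 3).castSucc = 2 := rfl
  fin_cases k <;> fin_cases j <;>
    simp only [Fin.zero_eta, Fin.mk_one, Fin.reduceFinMk, Matrix.of_apply, c0, c1, c2, hS, hT, hU]
      <;> rfl

/-! ### Integer solutions of the two-column inequalities -/

/-- The inequalities that `BoundedMinors` gives for two disjoint row sets with sums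
`(s₁, s₂)` and `(t₁, t₂)` in two of the columns. -/
structure PairCond (s₁ s₂ t₁ t₂ : ℤ) : Prop where
  s1 : |1 + s₁| ≤ 3
  s2 : |1 + s₂| ≤ 3
  s2' : |s₂| ≤ 3
  s3 : |s₁ - s₂| ≤ 3
  t1 : |t₁| ≤ 3
  t2 : |1 + t₂| ≤ 3
  t3 : |t₁ - t₂| ≤ 3
  d : |s₁ * t₂ - t₁ * s₂| ≤ 3
  d1 : |(1 + s₁) * t₂ - t₁ * s₂| ≤ 3
  d2 : |s₁ * t₂ - t₁ * (1 + s₂)| ≤ 3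
  d3 : |s₁ * (1 + t₂) - t₁ * s₂| ≤ 3
  d4 : |s₁ * t₂ - (1 + t₁) * s₂| ≤ 3
  d5 : |(1 + s₁) * t₂ - t₁ * (1 + s₂)| ≤ 3
  d6 : |s₁ * (1 + t₂) - (1 + t₁) * s₂| ≤ 3
  d7 : |(1 + s₁) * (1 + t₂) - t₁ * s₂| ≤ 3
  d8 : |s₁ * t₂ - (1 + t₁) * (1 + s₂)| ≤ 3

/-- The third unit entry is alone in class `2`, so that row of the matrix is `(0, 0, 1)` and a `2 ×
2` minor of the first two columns remains. -/
theorem BoundedMinors.pairCond {m : ℕ} {a b c : Fin m → ℤ} (h : BoundedMinors ![a, b, c])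
    {S T : Finset (Fin m)} (hST : Disjoint S T) :
    PairCond (∑ i ∈ S, a i) (∑ i ∈ S, b i) (∑ i ∈ T, a i) (∑ i ∈ T, b i) := by
  have H := fun x y => h.det_le ![x, y, 2] hST (Finset.disjoint_empty_right S)
    (Finset.disjoint_empty_right T)
  have H' := fun x y => h.det_le ![x, y, 2] (Finset.disjoint_empty_right S)
    (Finset.disjoint_empty_right S) (Finset.disjoint_empty_right _)
  have K := fun x y => h.det_le ![x, y, 2] (Finset.disjoint_empty_right T)
    (Finset.disjoint_empty_right T) (Finset.disjoint_empty_right _)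
  simp only [Matrix.det_fin_three] at H H' K
  constructor
  · have := H' 0 1
    simp at this; exact this
  · have := H' 1 0
    simp at this; rw [← abs_neg]; convert this using 2; ring
  · have := H' 1 3
    simp at this; exact this
  · have := H' 1 1
    simp at this; exact this
  · have := K 3 1
    simp at this; exact this
  · have := K 1 0
    simp at this; rw [← abs_neg]; convert this using 2; ring
  · have := K 1 1
    simp at this; exact this
  · have := H 3 3
    simp at this; convert this using 2; ring
  · have := H 0 3
    simp at this; convert this using 2; ring
  · have := H 3 0
    simp at this; convert this using 2; ring
  · have := H 3 1
    simp at this; convert this using 2; ring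
  · have := H 1 3
    simp at this; convert this using 2; ring
  · have := H 0 0
    simp at this; convert this using 2; ring
  · have := H 1 1
    simp at this; convert this using 2; ring
  · have := H 0 1
    simp at this; convert this using 2; ring
  · have := H 1 0
    simp at this; convert this using 2; ring

/-- Once `s₁`, `s₂` are numerals, the bilinear bounds become linear in `t₁`, `t₂`. -/
theorem PairCond.ones {t₁ t₂ : ℤ} (h : PairCond 1 1 t₁ t₂) :
    t₁ = t₂ ∨ t₁ = -2 ∧ t₂ = -1 ∨ t₁ = -1 ∧ t₂ = -2 ∨ t₁ = -1 ∧ t₂ = 0 ∨ t₁ = 0 ∧ t₂ = -1 := by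
  obtain ⟨-, -, -, -, -, -, -, h1, h2, h3, h4, h5, h6, h7, h8, h9⟩ := h
  rw [abs_le] at *
  omega

theorem PairCond.ones_of_lt {x y z : ℤ} (hxy : PairCond 1 1 x y) (hxz : PairCond 1 1 x z)
    (hyz : PairCond 1 1 y z) (hlt : x < y) :
    (x = -2 ∧ y = -1 ∨ x = -1 ∧ y = 0) ∧ (z = x ∨ z = y) := by
  have h1 := hxy.ones
  have h2 := hxz.ones
  have h3 := hyz.ones
  have h4 : x = -2 ∧ y = -1 ∨ x = -1 ∧ y = 0 := by omega
  refine ⟨h4, ?_⟩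
  rcases h4 with ⟨rfl, rfl⟩ | ⟨rfl, rfl⟩ <;> omega

theorem PairCond.two_one {t₁ t₂ : ℤ} (h : PairCond 2 1 t₁ t₂) :
    t₁ = -3 ∧ t₂ = -2 ∨ t₁ = -2 ∧ t₂ = -1 ∨ t₁ = -1 ∧ t₂ = -1 ∨ t₁ = 0 ∧ t₂ = 0 := by
  obtain ⟨-, -, -, -, -, -, -, h1, h2, h3, h4, h5, h6, h7, h8, h9⟩ := h
  rw [abs_le] at *
  omega

theorem PairCond.two_two {t₁ t₂ : ℤ} (h : PairCond 2 2 t₁ t₂) : t₁ = t₂ := by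
  obtain ⟨-, -, -, -, -, -, -, h1, h2, h3, h4, h5, h6, h7, h8, h9⟩ := h
  rw [abs_le] at *
  omega

theorem PairCond.two_nonpos {s₂ t₁ t₂ : ℤ} (h : PairCond 2 s₂ t₁ t₂) (hs : s₂ ≤ 0) : t₂ ≤ 0 := by
  obtain ⟨-, h10, h11, h12, k1, k2, k3, h1, h2, h3, h4, h5, h6, h7, h8, h9⟩ := h
  rw [abs_le] at *
  -- From `|2 - s₂| ≤ 3`.
  have : -1 ≤ s₂ := by omega
  interval_cases s₂ <;> omega

theorem PairCond.le_two {s₁ s₂ t₁ t₂ : ℤ} (h : PairCond s₁ s₂ t₁ t₂) : s₁ ≤ 2 ∧ s₂ ≤ 2 := by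
  obtain ⟨h1, h2, -⟩ := h
  rw [abs_le] at *
  omega

theorem PairCond.opposite {s₁ s₂ t₁ t₂ : ℤ} (h : PairCond s₁ s₂ t₁ t₂) (hs₁ : 1 ≤ s₁)
    (hs₂ : s₂ ≤ 0) (ht₂ : 1 ≤ t₂) :
    s₁ = 1 ∧ t₂ = 1 ∧ (s₂ = -1 ∨ s₂ = -2) ∧ (t₁ = -1 ∨ t₁ = -2) := by
  obtain ⟨h13, h10, h11, h12, k1, k2, k3, h1, h2, h3, h4, h5, h6, h7, h8, h9⟩ := h
  rw [abs_le] at *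
  have : s₁ ≤ 2 := by omega
  have : -2 ≤ s₂ := by omega
  interval_cases s₁ <;> interval_cases s₂ <;> omega

/-! ### Case analysis on common positive rows -/

section

variable {m : ℕ} {a b c : Fin m → ℤ}

theorem BoundedMinors.row (h : BoundedMinors ![a, b, c]) {i j : Fin m} (hij : i ≠ j) :
    PairCond (a i) (b i) (a j) (b j) := by
  simpa using h.pairCond (S := {i}) (T := {j}) (by simpa using hij)

theorem BoundedMinors.row_of_lt (h : BoundedMinors ![a, b, c]) {i p : Fin m}
    (ha : a i = 1) (hb : b i = 1) (hc : c i = 1) (hp : a p < b p) :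
    (a p = -2 ∧ b p = -1 ∨ a p = -1 ∧ b p = 0) ∧ (c p = a p ∨ c p = b p) := by
  have hpi : i ≠ p := by rintro rfl; omega
  have h1 := h.row hpi
  have h2 := h.swap12.row hpi
  have h3 := h.swap01.swap12.row hpi
  rw [ha, hb] at h1
  rw [ha, hc] at h2
  rw [hb, hc] at h3
  exact h1.ones_of_lt h2 h3 hp

theorem BoundedMinors.le_two (h : BoundedMinors ![a, b, c]) (i : Fin m) : a i ≤ 2 ∧ b i ≤ 2 := by
  simpa using (h.pairCond (S := {i}) (T := ∅) (by simp)).le_two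

theorem BoundedMinors.eq_of_two (h : BoundedMinors ![a, b, c]) {i : Fin m} (ha : a i = 2)
    (hb : b i = 2) : a = b := by
  funext l
  by_cases hl : i = l
  · rw [← hl, ha, hb]
  · have := h.row hl
    rw [ha, hb] at this
    exact this.two_two

/-- If `a i = 2`, then `b i = 1`. When `c i = 1` too, `two_one` makes `b l` and `c l` the same
function of `a l`, so `b = c`; when `c i ≤ 0`, `two_nonpos` leaves `c` no positive entry. -/
theorem BoundedMinors.ne_two (h : BoundedMinors ![a, b, c]) (hab : a ≠ b) (hac : a ≠ c)
    (hbc : b ≠ c) {i k : Fin m} (hb : 1 ≤ b i) (hk : 1 ≤ c k) : a i ≠ 2 := by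
  intro ha
  have hb2 : b i ≠ 2 := fun hb2 => hab (h.eq_of_two ha hb2)
  have hb1 : b i = 1 := by have := h.le_two i; omega
  have hc2 : c i ≠ 2 := fun hc2 => hac (h.swap12.eq_of_two ha hc2)
  have := h.swap12.le_two i
  by_cases hc : 1 ≤ c i
  · have hc1 : c i = 1 := by omega
    apply hbc
    funext l
    by_cases hl : i = l
    · rw [← hl, hb1, hc1]
    · have h1 := h.row hl
      have h2 := h.swap12.row hl
      rw [ha, hb1] at h1
      rw [ha, hc1] at h2
      have := h1.two_one
      have := h2.two_one
      omega
  · have hik : i ≠ k := by rintro rfl; exact hc hk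
    have h2 := h.swap12.row hik
    rw [ha] at h2
    have := h2.two_nonpos (by omega)
    omega

theorem BoundedMinors.eq_one (h : BoundedMinors ![a, b, c]) (hab : a ≠ b) (hac : a ≠ c)
    (hbc : b ≠ c) (hc : ∃ k, 1 ≤ c k) {i : Fin m} (ha : 1 ≤ a i) (hb : 1 ≤ b i) :
    a i = 1 ∧ b i = 1 := by
  obtain ⟨k, hk⟩ := hc
  have := h.ne_two hab hac hbc hb hk
  have := h.swap01.ne_two hab.symm hbc hac ha hk
  have := h.le_two i
  omega

theorem exists_lt_of_sum_eq (hs : ∑ i, a i = ∑ i, b i) (hab : a ≠ b) : ∃ i, a i < b i := by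
  by_contra! hle
  apply hab
  funext i
  exact ((Finset.sum_eq_sum_iff_of_le fun i _ => hle i).1 hs.symm i (Finset.mem_univ i)).symm

/-- No two of the columns have a common row with positive entries. -/
theorem BoundedMinors.false_of_disjoint (h : BoundedMinors ![a, b, c]) {i j k : Fin m}
    (ha : 1 ≤ a i) (hb : 1 ≤ b j) (hc : 1 ≤ c k) (haj : a j ≤ 0) (hak : a k ≤ 0) (hbi : b i ≤ 0)
    (hbk : b k ≤ 0) (hci : c i ≤ 0) (hcj : c j ≤ 0) : False := by
  have hij : i ≠ j := by rintro rfl; omega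
  have hik : i ≠ k := by rintro rfl; omega
  have hjk : j ≠ k := by rintro rfl; omega
  obtain ⟨ha1, hb1, hbi, haj⟩ := (h.row hij).opposite ha hbi hb
  obtain ⟨-, hc1, hci, hak⟩ := (h.swap12.row hik).opposite ha hci hc
  obtain ⟨-, -, hcj, hbk⟩ := (h.swap01.swap12.row hjk).opposite hb hcj hc
  -- The diagonal is `2, 1, 1` and the other entries are negative, so every other term of the
  -- expansion is negative and the determinant is at most `-4`.
  have := h.det_le ![0, 3, 3] (S := {i}) (T := {j}) (U := {k}) (by simpa) (by simpa) (by simpa)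
  simp [Matrix.det_fin_three, ha1, hb1, hc1, abs_le] at this
  rcases hbi with h1 | h1 <;> rcases haj with h2 | h2 <;> rcases hci with h3 | h3 <;>
  rcases hak with h4 | h4 <;> rcases hcj with h5 | h5 <;> rcases hbk with h6 | h6 <;>
  simp only [h1, h2, h3, h4, h5, h6] at this <;> omega

/-- Excludes `a k ≠ b k` in `false_of_pair`, where both entries lie in `{-1, -2}`. -/
theorem BoundedMinors.false_of_neg_two (h : BoundedMinors ![a, b, c]) {i k q : Fin m}
    (ha : a i = 1) (hb : b i = 1) (hci : c i = -1 ∨ c i = -2) (hc : c k = 1)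
    (hak : a k = -2) (hbk : b k = -1) (hq : b q < a q) : False := by
  have hik : i ≠ k := by rintro rfl; omega
  have hqi : i ≠ q := by rintro rfl; omega
  have hkq : k ≠ q := by rintro rfl; omega
  rcases hci with hci | hci
  · have := h.det_le ![0, 1, 0] (S := ∅) (T := {i}) (U := {k}) (by simp) (by simp) (by simpa)
    simp [Matrix.det_fin_three, ha, hb, hc, hci, hak, hbk] at this
  · have hqab := h.row hqi
    have hkab := h.row hkq
    have hqbc := (h.swap01.swap12.row hqi).d1
    rw [ha, hb] at hqab
    rw [hak, hbk] at hkab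
    have hqab' : a q = 0 ∧ b q = -1 := by
      rcases hqab.ones with h1 | h1 | h1 | h1 | h1
      · omega
      · omega
      · rw [h1.1, h1.2] at hkab
        have := hkab.d2
        norm_num at this
      · omega
      · exact h1
    have := h.det_le ![0, 1, 1] (S := {q}) (T := ∅) (U := {k}) (by simp)
      (by simpa using hkq.symm) (by simp)
    simp [Matrix.det_fin_three, hc, hak, hbk, hqab'] at this
    rw [hb, hci, hqab'.2, abs_le] at hqbc
    rw [abs_le] at this
    omega

/-- Two of the columns have a common row with positive entries, but not the third one. -/
theorem BoundedMinors.false_of_pair (h : BoundedMinors ![a, b, c])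
    (hs : ∑ i, a i = ∑ i, b i) (hab : a ≠ b) {i k : Fin m}
    (ha : a i = 1) (hb : b i = 1) (hci : c i ≤ 0) (hc : 1 ≤ c k) : False := by
  have hik : i ≠ k := by rintro rfl; omega
  obtain ⟨-, hc1, hci, hak⟩ := (h.swap12.row hik).opposite ha.ge hci hc
  obtain ⟨-, -, -, hbk⟩ := (h.swap01.swap12.row hik).opposite hb.ge (by omega) hc
  obtain ⟨p, hp⟩ := exists_lt_of_sum_eq hs hab
  obtain ⟨q, hq⟩ := exists_lt_of_sum_eq hs.symm hab.symm
  have hpi : i ≠ p := by rintro rfl; omega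
  have hqi : i ≠ q := by rintro rfl; omega
  have hpq : p ≠ q := by rintro rfl; omega
  have hpab := h.row hpi
  have hqab := h.row hqi
  rw [ha, hb] at hpab hqab
  have hqab := hqab.ones
  have hpab := hpab.ones
  by_cases h1 : a k = -2 ∧ b k = -1
  · exact h.false_of_neg_two ha hb hci hc1 h1.1 h1.2 hq
  by_cases h2 : a k = -1 ∧ b k = -2
  · exact h.swap01.false_of_neg_two hb ha hci hc1 h2.2 h2.1 hp
  have hpk : k ≠ p := by rintro rfl; omega
  have hqk : k ≠ q := by rintro rfl; omega
  have hak' : a k = -1 := by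
    -- If `a k = b k = -2`, the bound `d4` reads `2 * |1 + a q - b q| ≤ 3`, impossible as `b q < a
    -- q`.
    by_contra h3
    have h4 := (h.row hqk).d4
    rw [show a k = -2 by omega, show b k = -2 by omega, abs_le] at h4
    omega
  have hbk' : b k = -1 := by omega
  have hp' : a p = -1 ∧ b p = 0 := by
    have h3 := (h.swap12.row hpk).d5
    rw [hak', hc1, abs_le] at h3
    omega
  have hq' : a q = 0 ∧ b q = -1 := by
    have h3 := (h.swap01.swap12.row hqk).d5
    rw [hbk', hc1, abs_le] at h3
    omega
  -- Only `c p` and `c q` remain unknown, and they enter the bounds linearly.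
  rcases hci with hci | hci
  · have := h.det_le ![0, 1, 0] (S := ∅) (T := {i}) (U := {q}) (by simp) (by simp) (by simpa)
    simp [Matrix.det_fin_three, ha, hb, hci, hq'] at this
    have h3 := h.det_le ![0, 1, 1] (S := {i}) (T := ∅) (U := {k, q}) (by simp)
      (by simp [hik, hqi]) (by simp)
    simp [Matrix.det_fin_three, Finset.sum_pair hqk, ha, hb, hci, hak', hbk', hc1, hq'] at h3
    rw [abs_le] at this h3
    omega
  · have := h.det_le ![0, 3, 3] (S := {q}) (T := {i}) (U := {k, p}) (by simpa using hqi.symm)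
      (by simp [hqk.symm, hpq.symm]) (by simp [hik, hpi])
    simp [Matrix.det_fin_three, Finset.sum_pair hpk, ha, hb, hci, hak', hbk', hc1, hq', hp'] at this
    have h3 := (h.swap12.row hqi).d7
    have h4 := (h.swap01.swap12.row hpi).d7
    rw [ha, hci, hq'.1, abs_le] at h3
    rw [hb, hci, hp'.2, abs_le] at h4
    rw [abs_le] at this
    omega

/-- All columns have a common row with positive entries. -/
theorem BoundedMinors.eq_or_eq (h : BoundedMinors ![a, b, c]) {i p q : Fin m}
    (ha : a i = 1) (hb : b i = 1) (hc : c i = 1) (hp : a p < b p) (hq : b q < a q) :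
    c p = a p ∧ c q = a q ∨ c p = b p ∧ c q = b q := by
  have hpi : i ≠ p := by rintro rfl; omega
  have hqi : i ≠ q := by rintro rfl; omega
  have hpq : p ≠ q := by rintro rfl; omega
  obtain ⟨hp1, hp2⟩ := h.row_of_lt ha hb hc hp
  obtain ⟨hq1, hq2⟩ := h.swap01.row_of_lt hb ha hc hq
  have d := (h.row hpq).d2
  have d5 := (h.swap12.row hpq).d4
  have d6 := (h.swap01.swap12.row hpq).d1
  have d1 := h.det_le ![0, 3, 1] (S := {q}) (T := {i}) (U := {p}) (by simpa using hqi.symm)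
    (by simpa using hpq.symm) (by simpa)
  have d2 := h.det_le ![0, 1, 2] (S := {q}) (T := {p}) (U := {i}) (by simpa using hpq.symm)
    (by simpa using hqi.symm) (by simpa using hpi.symm)
  have d3 := h.det_le ![0, 3, 1] (S := {i}) (T := {p}) (U := {q}) (by simpa) (by simpa) (by simpa)
  have d4 := h.det_le ![0, 1, 2] (S := {i}) (T := {p}) (U := {q}) (by simpa) (by simpa) (by simpa)
  simp [Matrix.det_fin_three, ha, hb, hc] at d1 d2 d3 d4
  rw [abs_le] at d d1 d2 d3 d4 d5 d6
  rcases hp1 with ⟨p1, p2⟩ | ⟨p1, p2⟩ <;> rcases hq1 with ⟨q1, q2⟩ | ⟨q1, q2⟩ <;>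
    rcases hp2 with hp2 | hp2 <;> rcases hq2 with hq2 | hq2 <;>
    simp only [hp2, hq2, p1, p2, q1, q2] at d d1 d2 d3 d4 d5 d6 <;> omega

/-- As `c` agrees with `a` at `p` and `q`, equal sums force a third row `r` with `a r < c r`;
merging `q` with `r` supplies the bound that excludes the remaining cases. -/
theorem BoundedMinors.false_of_eq (h : BoundedMinors ![a, b, c]) {i p q : Fin m}
    (hs : ∑ i, a i = ∑ i, c i) (hac : a ≠ c)
    (ha : a i = 1) (hb : b i = 1) (hc : c i = 1) (hp : a p < b p) (hq : b q < a q)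
    (hpc : c p = a p) (hqc : c q = a q) : False := by
  obtain ⟨r, hr⟩ := exists_lt_of_sum_eq hs hac
  have hpi : i ≠ p := by rintro rfl; omega
  have hqi : i ≠ q := by rintro rfl; omega
  have hri : i ≠ r := by rintro rfl; omega
  have hpq : p ≠ q := by rintro rfl; omega
  have hpr : p ≠ r := by rintro rfl; omega
  have hqr : q ≠ r := by rintro rfl; omega
  obtain ⟨hp1, -⟩ := h.row_of_lt ha hb hc hp
  obtain ⟨hq1, -⟩ := h.swap01.row_of_lt hb ha hc hq
  obtain ⟨hr1, hr2⟩ := h.swap12.row_of_lt ha hc hb hr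
  have k1 := (h.row hpq).d2
  have k2 := (h.row hpr).d1
  have k3 := (h.swap12.row hpr).d1
  have k4 := (h.row hqr).d1
  have d := h.det_le ![3, 0, 1] (S := {i}) (T := {q, r}) (U := {p}) (by simp [hqi, hri])
    (by simpa) (by simp [hpq, hpr])
  simp [Matrix.det_fin_three, Finset.sum_pair hqr, ha, hb, hc] at d
  rw [abs_le] at d k1 k2 k3 k4
  rcases hp1 with ⟨p1, p2⟩ | ⟨p1, p2⟩ <;> rcases hq1 with ⟨q1, q2⟩ | ⟨q1, q2⟩ <;>
    rcases hr1 with ⟨r1, r2⟩ | ⟨r1, r2⟩ <;> rcases hr2 with hr2 | hr2 <;>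
    simp only [hpc, hqc, hr2, p1, p2, q1, q2, r1, r2] at d k1 k2 k3 k4 <;> omega

theorem BoundedMinors.false_of_common (h : BoundedMinors ![a, b, c]) {i : Fin m}
    (hs : ∑ i, a i = ∑ i, b i) (hs' : ∑ i, a i = ∑ i, c i) (hab : a ≠ b) (hac : a ≠ c)
    (hbc : b ≠ c) (ha : a i = 1) (hb : b i = 1) (hc : c i = 1) : False := by
  obtain ⟨p, hp⟩ := exists_lt_of_sum_eq hs hab
  obtain ⟨q, hq⟩ := exists_lt_of_sum_eq hs.symm hab.symm
  rcases h.eq_or_eq ha hb hc hp hq with ⟨hpc, hqc⟩ | ⟨hpc, hqc⟩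
  · exact h.false_of_eq hs' hac ha hb hc hp hq hpc hqc
  · exact h.swap01.false_of_eq (hs.symm.trans hs') hbc hb ha hc hq hp hqc hpc

theorem BoundedMinors.false_of_shared (h : BoundedMinors ![a, b, c])
    (hs : ∑ i, a i = ∑ i, b i) (hs' : ∑ i, a i = ∑ i, c i) (hab : a ≠ b) (hac : a ≠ c)
    (hbc : b ≠ c) (hc : ∃ k, 1 ≤ c k) {i : Fin m} (ha : 1 ≤ a i) (hb : 1 ≤ b i) : False := by
  obtain ⟨ha1, hb1⟩ := h.eq_one hab hac hbc hc ha hb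
  obtain ⟨k, hk⟩ := hc
  by_cases hci : 1 ≤ c i
  · obtain ⟨-, hc1⟩ := h.swap12.eq_one hac hab hbc.symm ⟨i, hb⟩ ha hci
    exact h.false_of_common hs hs' hab hac hbc ha1 hb1 hc1
  · exact h.false_of_pair hs hab ha1 hb1 (by omega) hk

theorem not_boundedMinors (hs : ∑ i, a i = ∑ i, b i) (hs' : ∑ i, a i = ∑ i, c i)
    (hab : a ≠ b) (hac : a ≠ c) (hbc : b ≠ c) (ha : ∃ i, 1 ≤ a i) (hb : ∃ i, 1 ≤ b i)
    (hc : ∃ i, 1 ≤ c i) : ¬ BoundedMinors ![a, b, c] := by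
  intro h
  have h1 : ∀ i, 1 ≤ a i → b i ≤ 0 := fun i hi => by
    by_contra! hi'
    exact h.false_of_shared hs hs' hab hac hbc hc hi hi'
  have h2 : ∀ i, 1 ≤ a i → c i ≤ 0 := fun i hi => by
    by_contra! hi'
    exact h.swap12.false_of_shared hs' hs hac hab hbc.symm hb hi hi'
  have h3 : ∀ i, 1 ≤ b i → c i ≤ 0 := fun i hi => by
    by_contra! hi'
    exact h.swap01.swap12.false_of_shared (hs.symm.trans hs') hs.symm hbc hab.symm hac.symm ha hi
      hi'
  obtain ⟨i, hi⟩ := ha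
  obtain ⟨j, hj⟩ := hb
  obtain ⟨k, hk⟩ := hc
  refine h.false_of_disjoint hi hj hk ?_ ?_ (h1 i hi) ?_ (h2 i hi) (h3 j hj)
  · by_contra! hn; have := h1 j hn; omega
  · by_contra! hn; have := h2 k hn; omega
  · by_contra! hn; have := h3 k hn; omega

end

/-! ### Rank and contraction of spanning forests -/

theorem rank_lt_of_sum_eq_zero {ι κ : Type*} [Fintype ι] [Fintype κ] [Nonempty ι]
    {A : Matrix ι κ ℚ} (h : ∀ j, ∑ i, A i j = 0) : A.rank < Fintype.card ι := by
  classical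
  rw [← Matrix.rank_transpose, Matrix.rank]
  have h1 := LinearMap.finrank_range_add_finrank_ker A.transpose.mulVecLin
  rw [Module.finrank_pi] at h1
  have h2 : 0 < Module.finrank ℚ (LinearMap.ker A.transpose.mulVecLin) := by
    rw [Module.finrank_pos_iff_exists_ne_zero]
    refine ⟨⟨fun _ => 1, ?_⟩, ?_⟩
    · rw [LinearMap.mem_ker]
      funext j
      simpa only [Matrix.mulVecLin_apply, Matrix.mulVec, dotProduct, Matrix.transpose_apply,
        mul_one, Pi.zero_apply] using h j
    · intro h0
      have := congrFun (congrArg Subtype.val h0) (Classical.arbitrary ι)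
      simp at this
  omega

theorem card_le_rank_of_det_ne_zero {ι κ ν : Type*} [Fintype ι] [Fintype κ] [Fintype ν]
    [DecidableEq ν] {A : Matrix ι κ ℚ} (f : ν → ι) (g : ν → κ) (h : (A.submatrix f g).det ≠ 0) :
    Fintype.card ν ≤ A.rank := by
  have h1 : (A.submatrix f g).rank = Fintype.card ν :=
    Matrix.rank_of_isUnit _ ((Matrix.isUnit_iff_isUnit_det _).2 (isUnit_iff_ne_zero.2 h))
  exact h1 ▸ Matrix.rank_submatrix_le A f g

/-- The position in `cliqueMatrix n` of the column `e_i - e_j` or its negative. -/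
def cliqueEdge {n : ℕ} (i j : Fin n) (h : i ≠ j) : {p : Fin n × Fin n // p.1 < p.2} :=
  if hlt : i < j then ⟨(i, j), hlt⟩ else ⟨(j, i), lt_of_le_of_ne (not_lt.1 hlt) h.symm⟩

theorem cliqueMatrix_cliqueEdge {n : ℕ} {i j : Fin n} (h : i ≠ j) (l : Fin n) :
    cliqueMatrix n l (cliqueEdge i j h) =
      ((if l = i then 1 else 0) - if l = j then 1 else 0) * if i < j then 1 else -1 := by
  unfold cliqueEdge
  split_ifs <;> simp_all [cliqueMatrix, Pi.single_apply]

theorem sum_eq_sum_section {n : ℕ} {color : Fin n → Fin 4} {root : Fin 4 → Fin n}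
    (hroot : ∀ k, color (root k) = k) (F : Fin n → ℤ) (k : Fin 4) :
    ∑ i with color i = k, F i =
      F (root k) + ∑ i : {i // i ≠ root (color i)}, if color i.1 = k then F i.1 else 0 := by
  rw [Finset.sum_filter, ← Finset.sum_filter_add_sum_filter_not _ fun i => i = root (color i)]
  congr 1
  · rw [Finset.sum_eq_single (root k)]
    · simp [hroot]
    · intro i hi hik
      rw [Finset.mem_filter] at hi
      rw [if_neg]
      rintro rfl
      exact hik hi.2
    · simp [hroot]
  · exact (Finset.sum_subtype _ (by simp) _)

/-- Contracting the colour classes of a spanning forest. -/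
theorem abs_det_forest {n : ℕ} (Y : Matrix (Fin n) (Fin 3) ℤ) {color : Fin n → Fin 4}
    {root : Fin 4 → Fin n} (hroot : ∀ k, color (root k) = k) :
    |((Matrix.fromCols (cliqueMatrix n) Y).submatrix
      (Sum.elim (fun k : Fin 3 => root k.castSucc)
        (Subtype.val : {i // i ≠ root (color i)} → Fin n))
      (Sum.elim Sum.inr fun i => Sum.inl (cliqueEdge i.1 _ i.2))).det| =
    |(Matrix.of fun k j : Fin 3 => ∑ i with color i = k.castSucc, Y i j).det| := by
  classical
  -- Up to column signs, the non-root rows of the forest columns form an identity block; its Schur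
  -- complement adds each non-root row to its root's row.
  have key : (Matrix.fromCols (cliqueMatrix n) Y).submatrix
      (Sum.elim (fun k : Fin 3 => root k.castSucc)
        (Subtype.val : {i // i ≠ root (color i)} → Fin n))
      (Sum.elim Sum.inr fun i => Sum.inl (cliqueEdge i.1 _ i.2)) =
      Matrix.fromBlocks (Matrix.of fun k j => Y (root k.castSucc) j)
        (Matrix.of fun k i => if color i.1 = k.castSucc then -1 else 0)
        (Matrix.of fun i j => Y i.1 j) 1 *
      Matrix.diagonal (Sum.elim (fun _ => 1) fun i => if i.1 < root (color i.1) then 1 else -1) := by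
    ext (k | i) (j | l)
    · simp [Matrix.mul_diagonal]
    · simp only [Matrix.submatrix_apply, Sum.elim_inl, Sum.elim_inr, Matrix.fromCols_apply_inl,
        cliqueMatrix_cliqueEdge, Matrix.mul_diagonal, Matrix.fromBlocks_apply₁₂, Matrix.of_apply]
      congr 1
      have h1 : root k.castSucc ≠ l.1 := fun h => l.2 (by rw [← h, hroot])
      have h2 : root k.castSucc = root (color l.1) ↔ color l.1 = k.castSucc := by
        constructor
        · intro h
          rw [← hroot k.castSucc, h, hroot]
        · intro h
          rw [h]
      simp only [h1, h2, if_false]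
      split_ifs <;> rfl
    · simp [Matrix.mul_diagonal]
    · simp only [Matrix.submatrix_apply, Sum.elim_inr, Matrix.fromCols_apply_inl,
        cliqueMatrix_cliqueEdge, Matrix.mul_diagonal, Matrix.fromBlocks_apply₂₂, Matrix.one_apply]
      congr 1
      have h1 : i.1 ≠ root (color l.1) := fun h => i.2 (by rw [h, hroot])
      simp [h1, Subtype.ext_iff]
  rw [key, Matrix.det_mul, Matrix.det_diagonal, Matrix.det_fromBlocks_one₂₂, abs_mul,
    Finset.abs_prod]
  have hs : ∀ x : Fin 3 ⊕ {i // i ≠ root (color i)}, |(Sum.elim (fun _ => 1)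
      (fun i => if i.1 < root (color i.1) then 1 else -1) x : ℤ)| = 1 := by
    rintro (k | i)
    · simp
    · simp only [Sum.elim_inr]
      split_ifs <;> simp
  rw [Finset.prod_congr rfl fun x _ => hs x, Finset.prod_const_one, mul_one]
  congr 2
  ext k j
  rw [Matrix.of_apply, sum_eq_sum_section hroot]
  simp [Matrix.mul_apply, ite_mul, Finset.sum_ite]

theorem cliqueEdge_injective {n : ℕ} {color : Fin n → Fin 4} {root : Fin 4 → Fin n}
    (hroot : ∀ k, color (root k) = k) :
    Function.Injective fun i : {i // i ≠ root (color i)} => cliqueEdge i.1 _ i.2 := by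
  rintro ⟨i, hi⟩ ⟨j, hj⟩ h
  have h1 : i ≠ root (color j) := fun h => hi (by rw [h, hroot])
  have h2 : j ≠ root (color i) := fun h => hj (by rw [h, hroot])
  simp only [cliqueEdge] at h
  split_ifs at h <;> simp_all [Subtype.ext_iff]

theorem card_forest {n : ℕ} {color : Fin n → Fin 4} {root : Fin 4 → Fin n}
    (hroot : ∀ k, color (root k) = k) :
    Fintype.card (Fin 3 ⊕ {i // i ≠ root (color i)}) + 1 = n := by
  have h1 := Fintype.card_subtype_compl fun i => i = root (color i)
  have h2 : Fintype.card {i // i = root (color i)} = 4 := by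
    rw [← Fintype.card_fin 4]
    exact Fintype.card_congr ⟨fun i => color i.1, fun k => ⟨root k, by rw [hroot]⟩,
      fun i => Subtype.ext i.2.symm, hroot⟩
  have h3 := Fintype.card_subtype_le fun i => i = root (color i)
  rw [Fintype.card_fin] at h1 h3
  change Fintype.card {i // i ≠ root (color i)} = _ at h1
  rw [Fintype.card_sum, Fintype.card_fin]
  omega

/-- A violating colouring has nonzero determinant, so uses all four colours. Choosing four roots
leaves `m - 1` forest columns; with the last three columns this makes `m + 2`, exactly the rank. -/
theorem boundedMinors_of_isDeltaModular {m : ℕ} {a b c : Fin m → ℤ}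
    (hsum : ∀ j, ∑ i, cliqueExtension a b c i j = 0)
    (h : IsDeltaModular 3 (cliqueExtension a b c)) : BoundedMinors ![a, b, c] := by
  classical
  intro ε χ
  set Y := extensionColumns a b c with hY
  have hM : (Matrix.of fun k j : Fin 3 => (if ε j = k.castSucc then (1 : ℤ) else 0) +
      ∑ i with χ i = k.castSucc, (![a, b, c] : Fin 3 → Fin m → ℤ) j i) =
      Matrix.of fun k j : Fin 3 => ∑ i with Fin.append χ ε i = k.castSucc, Y i j := by
    ext k j
    have h1 : ∀ i, Y (Fin.castAdd 3 i) j = (![a, b, c] : Fin 3 → Fin m → ℤ) j i := fun i => by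
      simp [hY, extensionColumns]
    have h2 : ∀ i, Y (Fin.natAdd m i) j = if i = j then 1 else 0 := fun i => by
      simp [hY, extensionColumns, Pi.single_apply]
    simp only [Matrix.of_apply, Finset.sum_filter]
    rw [Fin.sum_univ_add, add_comm]
    simp only [Fin.append_left, Fin.append_right, h1, h2]
    congr 1
    rw [Finset.sum_eq_single j]
    · simp
    · intro i _ hij
      simp [hij]
    · simp
  rw [hM]
  by_contra! hlt
  set color := Fin.append χ ε
  set M := Matrix.of fun k j : Fin 3 => ∑ i with color i = k.castSucc, Y i j with hMdef
  have hdet : M.det ≠ 0 := fun h0 => by rw [h0] at hlt; norm_num at hlt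
  have hYsum : ∀ j, ∑ i, Y i j = 0 := fun j => by simpa [cliqueExtension] using hsum (Sum.inr j)
  have hsurj : Function.Surjective color := by
    intro k
    by_contra! hk
    induction k using Fin.lastCases with
    | cast k =>
      refine hdet (Matrix.det_eq_zero_of_row_eq_zero k fun j => ?_)
      simp [hMdef, Finset.filter_false_of_mem fun i _ => hk i]
    | last =>
      -- With no ignored rows, the three class sums add up to the zero row.
      have : (fun _ => 1 : Fin 3 → ℤ) = 0 := Matrix.eq_zero_of_vecMul_eq_zero hdet (by
        funext j
        rw [Matrix.vecMul, dotProduct, Pi.zero_apply, ← hYsum j,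
          ← Finset.sum_fiberwise (g := color), Fin.sum_univ_castSucc (n := 3)]
        rw [Finset.filter_false_of_mem fun i _ => hk i]
        simp [hMdef])
      simpa using congrFun this 0
  obtain ⟨root, hroot⟩ := hsurj.hasRightInverse
  have hdet' := abs_det_forest Y hroot
  rw [← hMdef] at hdet'
  set f : Fin 3 ⊕ {i // i ≠ root (color i)} → Fin (m + 3) :=
    Sum.elim (fun k : Fin 3 => root k.castSucc) Subtype.val with hf
  set g : Fin 3 ⊕ {i // i ≠ root (color i)} →
    {p : Fin (m + 3) × Fin (m + 3) // p.1 < p.2} ⊕ Fin 3 :=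
    Sum.elim Sum.inr fun i => Sum.inl (cliqueEdge i.1 _ i.2) with hg
  have hfinj : Function.Injective f := by
    refine Function.Injective.sumElim ?_ Subtype.val_injective ?_
    · exact hroot.injective.comp (Fin.castSucc_injective 3)
    · intro k i hki
      exact i.2 (by rw [← hki, hroot])
  have hginj : Function.Injective g :=
    Function.Injective.sumElim Sum.inr_injective
      (Sum.inl_injective.comp (cliqueEdge_injective hroot)) fun _ _ => Sum.inr_ne_inl
  have hcard := card_forest hroot
  have hrank : ((cliqueExtension a b c).map (Int.cast : ℤ → ℚ)).rank =
      Fintype.card (Fin 3 ⊕ {i // i ≠ root (color i)}) := by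
    apply le_antisymm
    · have := rank_lt_of_sum_eq_zero (A := (cliqueExtension a b c).map (Int.cast : ℤ → ℚ))
        fun j => by simpa using congrArg (Int.cast : ℤ → ℚ) (hsum j)
      rw [Fintype.card_fin] at this
      omega
    · refine card_le_rank_of_det_ne_zero f g ?_
      rw [Matrix.submatrix_map]
      have h1 := (Int.castRingHom ℚ).map_det ((cliqueExtension a b c).submatrix f g)
      simp only [RingHom.mapMatrix_apply, Int.coe_castRingHom] at h1
      rw [← h1, Int.cast_ne_zero, ← abs_ne_zero]
      exact hdet'.trans_ne (abs_ne_zero.2 hdet)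
  have e := (Fin.castOrderIso hrank).toEquiv.trans (Fintype.equivFin _).symm
  have := h (e.toEmbedding.trans ⟨f, hfinj⟩) (e.toEmbedding.trans ⟨g, hginj⟩)
  have h2 : (cliqueExtension a b c).submatrix (e.toEmbedding.trans ⟨f, hfinj⟩)
      (e.toEmbedding.trans ⟨g, hginj⟩) = ((cliqueExtension a b c).submatrix f g).submatrix e e := rfl
  rw [h2, Matrix.det_submatrix_equiv_self] at this
  have h3 : |((cliqueExtension a b c).submatrix f g).det| = |M.det| := hdet'
  rw [h3] at this
  exact absurd hlt (not_lt.2 this)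

/-! ### Positive entries and conclusion -/

/-- Were all other entries nonpositive, the zero sum would leave exactly one `-1`, making `x` equal
to `e_l - e_i`. -/
theorem exists_pos_of_not_isParallel {n : ℕ} {x : Fin n → ℤ} (hx : ∑ i, x i = 0) {l : Fin n}
    (hl : x l = 1) (hpar : ∀ p, ¬ IsParallel (fun i => cliqueMatrix n i p) x) :
    ∃ i ≠ l, 1 ≤ x i := by
  by_contra! hle
  obtain ⟨i, hil, hi⟩ : ∃ i ≠ l, x i < 0 := by
    by_contra! hge
    have h1 : x l ≤ ∑ i, x i := Finset.single_le_sum (fun i _ => by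
      by_cases h : i = l
      · rw [h, hl]; norm_num
      · exact hge i h) (Finset.mem_univ l)
    omega
  -- The complement of `s` avoids `l`, so its sum is nonpositive.
  have h0 : ∀ s : Finset (Fin n), l ∈ s → 0 ≤ ∑ j ∈ s, x j := fun s hs => by
    rw [← hx, ← Finset.sum_add_sum_compl s]
    have : ∑ j ∈ sᶜ, x j ≤ 0 := Finset.sum_nonpos fun j hj => by
      have := hle j (by rintro rfl; exact Finset.mem_compl.1 hj hs)
      omega
    omega
  have hi1 : x i = -1 := by
    have := h0 {i, l} (by simp)
    rw [Finset.sum_pair hil] at this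
    omega
  have hj0 : ∀ j, j ≠ l → j ≠ i → x j = 0 := fun j hjl hji => by
    have := h0 {j, i, l} (by simp)
    rw [Finset.sum_insert (by simp [hjl, hji]), Finset.sum_pair hil] at this
    have := hle j hjl
    omega
  refine hpar (cliqueEdge l i hil.symm) ⟨if l < i then 1 else -1, by split_ifs <;> simp, ?_⟩
  intro j
  simp only [cliqueMatrix_cliqueEdge]
  by_cases h1 : j = l
  · subst h1
    rw [hl]
    split_ifs <;> simp_all
  by_cases h2 : j = i
  · subst h2
    rw [hi1]
    split_ifs <;> simp_all
  · rw [hj0 j h1 h2]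
    simp [h1, h2]

theorem mainTheorem8 (m : ℕ) (a b c : Fin m → ℤ)
    (hsum : ∀ j, ∑ i, cliqueExtension a b c i j = 0)
    (hpar : NoParallelColumns (cliqueExtension a b c))
    (hab : a ≠ b) (hac : a ≠ c) (hbc : b ≠ c) :
    ¬ IsDeltaModular 3 (cliqueExtension a b c) := by
  have h1 : ∀ j i, cliqueExtension a b c (Fin.castAdd 3 i) (Sum.inr j) =
      (![a, b, c] : Fin 3 → Fin m → ℤ) j i := fun j i => by
    simp [cliqueExtension, extensionColumns]
  have h2 : ∀ j i, cliqueExtension a b c (Fin.natAdd m i) (Sum.inr j) = if i = j then 1 else 0 :=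
    fun j i => by simp [cliqueExtension, extensionColumns, Pi.single_apply]
  have hs : ∀ j, ∑ i, (![a, b, c] : Fin 3 → Fin m → ℤ) j i = -1 := fun j => by
    have := hsum (Sum.inr j)
    rw [Fin.sum_univ_add] at this
    simp only [h1, h2, Finset.sum_ite_eq', Finset.mem_univ, if_true] at this
    omega
  have hpos : ∀ j, ∃ i, 1 ≤ (![a, b, c] : Fin 3 → Fin m → ℤ) j i := fun j => by
    obtain ⟨i, hij, hi⟩ := exists_pos_of_not_isParallel (hsum (Sum.inr j)) (l := Fin.natAdd m j)
      (by simp [h2]) fun p => hpar (Sum.inl p) (Sum.inr j) Sum.inl_ne_inr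
    induction i using Fin.addCases with
    | left i => exact ⟨i, by rwa [h1] at hi⟩
    | right i =>
      rw [h2, if_neg (by rintro rfl; exact hij rfl)] at hi
      omega
  intro h
  exact not_boundedMinors ((hs 0).trans (hs 1).symm) ((hs 0).trans (hs 2).symm) hab hac hbc
    (hpos 0) (hpos 1) (hpos 2) (boundedMinors_of_isDeltaModular hsum h)
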